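/- **Notation.** Let $A$ be a unital C$^*$-algebra. For positive $a,b\in A$ write $a\lesssim b$ if there is a sequence $(x_n)$ in $A$ with $\|a-x_nbx_n^*\|\to 0$. For $\varepsilon>0$ let $f_\varepsilon:[0,\infty)\to[0,1]$ be the continuous function that is $0$ on $[0,\varepsilon/2]$, linear on $[\varepsilon/2,\varepsilon]$ and $1$ on $[\varepsilon,\infty)$, and for a state $\varphi$ of $A$ and a positive $a\in A$ put $D_\varphi(a)=\lim_{\varepsilon\to0^+}\varphi(f_\varepsilon(a))$. For a compact (in the weak-$*$ topology) convex set $\mathcal Q$ of states, $\mathrm{Aff}(\mathcal Q)$ is the real vector space of continuous affine functions $\mathcal Q\to\mathbb R$, with the strict ordering ($f\ge 0$ iff $f=0$ or $f(\varphi)>0$ for all $\varphi\in\mathcal Q$) and the topology induced by this ordering (its order topology, generated by the sets $\{f : f<g\}$ and $\{f : g<f\}$ with $g\in\mathrm{Aff}(\mathcal Q)$), and $[0,1]=\{f\in\mathrm{Aff}(\mathcal Q)\mid 0\le f\le 1\}$. A self-adjoint $a\in A$ induces $\hat a\in\mathrm{Aff}(\mathcal Q)$, $\hat a(\varphi)=\varphi(a)$.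 The stable rank $\mathrm{sr}(A)$ is the least $n\ge1$ such that the $n$-tuples that generate $A$ as a left ideal are dense in $A^n$ ($\infty$ if there is none); thus $\mathrm{sr}(A)=1$ iff the invertible elements are dense in $A$. $\mathrm{RR}(A)=0$ means that the invertible self-adjoint elements are dense in the set of self-adjoint elements. A projection $p$ is infinite if $p=v^*v$ for some $v\in A$ with $vv^*\le p$ and $vv^*\ne p$; it is full if the closed two-sided ideal it generates is $A$. $A$ is simple if $A\neq0$ and its only closed two-sided ideals are $0$ and $A$; it is simple and purely infinite if moreover every nonzero hereditary C$^*$-subalgebra of $A$ contains an infinite projection. **Theorem.** Let $A$ be a unital C$^*$-algebra, let $\mathcal Q$ be a nonempty compact convex subset of the state space of $A$, let $\Pi$ be a subset of the set of projections in $A$, and let $\mathfrak A$ be a dense $*$-subalgebra of $A$ that is closed under continuous functional calculus on its normal elements. Assume that each state in $\mathcal Q$ is faithful on $\mathfrak A$ (that is, it vanishes at no nonzero positive element of $\mathfrak A$), that for all positive $a\in\mathfrak A$ and all $p\in\Pi$ * ($\alpha$) if $D_\varphi(a)<\varphi(p)$ for all $\varphi\in\mathcal Q$, then $a\lesssim p$,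 * ($\beta$) if $\varphi(p)<D_\varphi(a)$ for all $\varphi\in\mathcal Q$, then $p\lesssim a$, and that * ($\gamma$) $\{\hat p\mid p\in\Pi\}$ is dense in the interval $[0,1]$ of $\mathrm{Aff}(\mathcal Q)$, i.e. every element of $[0,1]$ lies in its closure. Then * (i) if $\mathrm{sr}(A)=1$, then $\mathrm{RR}(A)=0$; and * (ii) if all nonzero projections in $\Pi$ are infinite and full, then $A$ is simple and purely infinite. -/

import Mathlib

open Filter Topology

namespace CStarComparison

section Aff

variable {E : Type*} [AddCommGroup E] [Module ℝ E] [TopologicalSpace E]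

/-- The continuous functions `f : Q → ℝ` that respect all convex combinations existing in `Q`,
as a subspace of the real vector space `C(Q, ℝ)`. -/
def affSubmodule (Q : Set E) : Submodule ℝ C(Q, ℝ) where
  carrier := {f | ∀ (x y z : Q) (s t : ℝ), 0 ≤ s → 0 ≤ t → s + t = 1 →
    (z : E) = s • (x : E) + t • (y : E) → f z = s * f x + t * f y}
  add_mem' := by
    intro f g hf hg x y z s t hs ht hst h
    simp only [ContinuousMap.add_apply, hf x y z s t hs ht hst h, hg x y z s t hs ht hst h]
    ring
  zero_mem' := by
    intro x y z s t hs ht hst h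
    simp
  smul_mem' := by
    intro c f hf x y z s t hs ht hst h
    simp only [ContinuousMap.smul_apply, smul_eq_mul, hf x y z s t hs ht hst h]
    ring

/-- `Aff(Q)`: the real vector space of continuous affine functions `Q → ℝ`. It is a type of its
own because it carries the strict order and the topology of that order (below), rather than the
pointwise order and the topology of `C(Q, ℝ)`. -/
def Aff (Q : Set E) : Type _ := affSubmodule Q

variable {Q : Set E}

instance : AddCommGroup (Aff Q) := inferInstanceAs (AddCommGroup (affSubmodule Q))

instance : Module ℝ (Aff Q) := inferInstanceAs (Module ℝ (affSubmodule Q))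

instance : CoeFun (Aff Q) (fun _ => Q → ℝ) := ⟨fun f x => f.1 x⟩

theorem Aff.ext {f g : Aff Q} (h : ∀ x, f x = g x) : f = g :=
  Subtype.ext (ContinuousMap.ext h)

/-- The constant function `1`. -/
instance : One (Aff Q) :=
  ⟨⟨1, by
    intro x y z s t _ _ hst _
    simp [hst]⟩⟩

/-- The strict ordering: `f ≤ g` iff `g - f` is zero or is strictly positive everywhere on `Q`. -/
instance : PartialOrder (Aff Q) where
  le f g := g - f = 0 ∨ ∀ x, 0 < (g - f) x
  le_refl f := Or.inl (sub_self f)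
  le_trans := by
    rintro f g h (h1 | h1) (h2 | h2)
    · left; rw [sub_eq_zero] at *; rw [h2, h1]
    · right; rw [sub_eq_zero] at h1; subst h1; exact h2
    · right; rw [sub_eq_zero] at h2; subst h2; exact h1
    · right
      intro x
      have e : (h - f) x = (h - g) x + (g - f) x := by
        rw [← sub_add_sub_cancel h g f]; rfl
      rw [e]
      exact add_pos (h2 x) (h1 x)
  le_antisymm := by
    rintro f g (h1 | h1) (h2 | h2)
    · exact (sub_eq_zero.mp h1).symm
    · exact (sub_eq_zero.mp h1).symm
    · exact sub_eq_zero.mp h2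
    · refine Aff.ext fun x => ?_
      have a : 0 < g x - f x := h1 x
      have b : 0 < f x - g x := h2 x
      linarith

/-- The topology induced by the strict ordering. -/
instance : TopologicalSpace (Aff Q) := Preorder.topology (Aff Q)

end Aff

section States

variable {A : Type*} [CStarAlgebra A]

/-- The element `â : φ ↦ φ(a)` of `Aff(Q)` induced by a self-adjoint `a`. States are real on
self-adjoint elements, so taking the real part only changes the type of the value. -/
noncomputable def affHat (Q : Set (WeakDual ℂ A)) (a : A) : Aff Q :=
  ⟨⟨fun φ => ((φ : WeakDual ℂ A) a).re,
    Complex.continuous_re.comp ((WeakDual.eval_continuous a).comp continuous_subtype_val)⟩, by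
    intro x y z s t _ _ _ h
    change ((z : WeakDual ℂ A) a).re = s * ((x : WeakDual ℂ A) a).re
      + t * ((y : WeakDual ℂ A) a).re
    rw [h]
    change (s • ((x : WeakDual ℂ A) a) + t • ((y : WeakDual ℂ A) a)).re = _
    simp⟩

variable [PartialOrder A]

open scoped ComplexOrder in
/-- A state: a positive functional with value `1` at the unit. The ambient space `WeakDual ℂ A` is
the dual of `A` with the weak-* topology. -/
structure IsState (φ : WeakDual ℂ A) : Prop where
  nonneg : ∀ a : A, 0 ≤ a → 0 ≤ φ a
  map_one : φ 1 = 1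

/-- `φ` is faithful on `S`: it vanishes at no nonzero positive element of `S`. -/
def IsFaithfulOn (φ : WeakDual ℂ A) (S : NonUnitalStarSubalgebra ℂ A) : Prop :=
  ∀ a ∈ S, 0 ≤ a → φ a = 0 → a = 0

end States

/-- `f_ε`: zero on `[0, ε/2]`, linear on `[ε/2, ε]`, one on `[ε, ∞)`. -/
noncomputable def fEps (ε t : ℝ) : ℝ := max 0 (min 1 (2 * t / ε - 1))

theorem continuous_fEps (ε : ℝ) : Continuous (fEps ε) := by
  unfold fEps
  fun_prop

section Algebra

variable {A : Type*} [CStarAlgebra A]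

/-- `D_φ(a) = lim_{ε → 0+} φ(f_ε(a))` for positive `a`; the limit exists by
`tendsto_dimFn` below. -/
noncomputable def dimFn (φ : WeakDual ℂ A) (a : A) : ℝ :=
  limUnder (𝓝[>] (0 : ℝ)) fun ε => (φ (cfc (fEps ε) a)).re

/-- The limit in the definition of `D_φ(a)` exists, so `dimFn` is not a default value. -/
theorem tendsto_dimFn [PartialOrder A] [StarOrderedRing A] {φ : WeakDual ℂ A} (hφ : IsState φ)
    {a : A} (ha : 0 ≤ a) :
    Tendsto (fun ε => (φ (cfc (fEps ε) a)).re) (𝓝[>] (0 : ℝ)) (𝓝 (dimFn φ a)) := by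
  have hpos : ∀ x : A, 0 ≤ x → 0 ≤ (φ x).re := fun x hx => (Complex.le_def.mp (hφ.nonneg x hx)).1
  have hmono : ∀ x y : A, x ≤ y → (φ x).re ≤ (φ y).re := fun x y hxy => by
    have h := hpos (y - x) (sub_nonneg.mpr hxy)
    rw [map_sub, Complex.sub_re] at h
    linarith
  have hsa : IsSelfAdjoint a := IsSelfAdjoint.of_nonneg ha
  have hanti : AntitoneOn (fun ε => (φ (cfc (fEps ε) a)).re) (Set.Ioi 0) := by
    intro ε hε δ hδ hεδ
    refine hmono _ _ (cfc_mono (fun t ht => ?_) (continuous_fEps _).continuousOn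
      (continuous_fEps _).continuousOn)
    have ht0 : 0 ≤ t := spectrum_nonneg_of_nonneg ha ht
    have : 2 * t / δ ≤ 2 * t / ε := div_le_div_of_nonneg_left (by positivity) hε hεδ
    exact max_le_max le_rfl (min_le_min le_rfl (by linarith))
  have hbdd : BddAbove ((fun ε => (φ (cfc (fEps ε) a)).re) '' Set.Ioi 0) := by
    refine ⟨1, ?_⟩
    rintro _ ⟨ε, -, rfl⟩
    have h : cfc (fEps ε) a ≤ 1 := cfc_le_one _ _ fun t _ => by
      unfold fEps
      exact max_le zero_le_one (min_le_left _ _)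
    have h1 := hmono _ _ h
    rw [hφ.map_one, Complex.one_re] at h1
    exact h1
  exact tendsto_nhds_limUnder ⟨_, hanti.tendsto_nhdsGT hbdd⟩

/-- Cuntz comparison `a ≲ b` of positive elements: `‖a - xₙ b xₙ*‖ → 0` for some sequence `xₙ`. -/
def CuntzLE (a b : A) : Prop :=
  ∃ x : ℕ → A, Tendsto (fun n => ‖a - x n * b * star (x n)‖) atTop (𝓝 0)

/-- `S` is closed under continuous functional calculus on its normal elements. -/
def ClosedUnderCFC (S : NonUnitalStarSubalgebra ℂ A) : Prop :=
  ∀ a ∈ S, IsStarNormal a → ∀ f : ℂ → ℂ, ContinuousOn f (spectrum ℂ a) → cfc f a ∈ S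

variable (A) in
/-- The stable rank of `A`: the least `n ≥ 1` such that the `n`-tuples generating `A` as a left
ideal are dense in `Aⁿ`, and `∞` if there is no such `n`. -/
noncomputable def stableRank : ℕ∞ :=
  ⨅ n ∈ {n : ℕ | 1 ≤ n ∧ Dense {a : Fin n → A | ∃ b : Fin n → A, ∑ i, b i * a i = 1}}, (n : ℕ∞)

variable (A) in
/-- `RR(A) = 0`: the invertible self-adjoint elements are dense in the self-adjoint elements. -/
def RealRankZero : Prop :=
  {a : A | IsSelfAdjoint a} ⊆ closure {a : A | IsSelfAdjoint a ∧ IsUnit a}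

/-- `p` is an infinite projection: `p` is equivalent to a proper subprojection of itself. (The
range projection `v v*` is a subprojection of `p` when `p v v* = v v*`.) -/
def IsInfiniteProjection (p : A) : Prop :=
  IsStarProjection p ∧ ∃ v : A, star v * v = p ∧ p * (v * star v) = v * star v ∧ v * star v ≠ p

/-- `a` is full: the closed two-sided ideal generated by `a` is all of `A`. -/
def IsFull (a : A) : Prop :=
  closure (TwoSidedIdeal.span {a} : Set A) = Set.univ

variable (A) in
/-- `A` is a simple C*-algebra: it is nonzero and `0` and `A` are its only closed two-sided
ideals. -/
def IsSimpleCStar : Prop :=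
  Nontrivial A ∧ ∀ I : TwoSidedIdeal A, IsClosed (I : Set A) → I = ⊥ ∨ I = ⊤

/-- `B` is a hereditary (C*-)subalgebra: norm closed, and `0 ≤ a ≤ b ∈ B` implies `a ∈ B`. -/
structure IsHereditary [PartialOrder A] (B : NonUnitalStarSubalgebra ℂ A) : Prop where
  isClosed : IsClosed (B : Set A)
  mem_of_le : ∀ a b : A, 0 ≤ a → a ≤ b → b ∈ B → a ∈ B

variable (A) in
/-- `A` is simple and purely infinite (Cuntz): it is simple, and every nonzero hereditary
subalgebra contains an infinite projection. -/
def IsSimplePurelyInfinite [PartialOrder A] : Prop :=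
  IsSimpleCStar A ∧ ∀ B : NonUnitalStarSubalgebra ℂ A, IsHereditary B → (∃ b ∈ B, b ≠ 0) →
    ∃ p ∈ B, IsInfiniteProjection p

end Algebra

end CStarComparison

/-! For (i), approximate by a self-adjoint `a ∈ S`. If the spectrum misses a point near `0`, a
scalar shift makes `a` invertible. Otherwise spectrum near `0`, with faithfulness and compactness,
leaves uniform room on both sides of a ramp function of `a`, so (γ) gives `p` strictly between the
dimensions of `c² = (a - 2η)₊²` and `e = (a + 2η)₊` (`exists_interpolating_projection`). By (α) and
(β), `c² ≲ p ≲ e`. As `e` is orthogonal to `b = (-a - 2η)₊`, so is a projection equivalent to `p`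
(`CuntzLE.exists_orthogonal`). Stable rank one supplies a unitary rotating that projection until it
nearly contains `c` and nearly annihilates `b`. Then `c - b`, which is close to `a`, is nearly block
diagonal with a positive and a negative block, and a small perturbation makes it invertible
(`exists_isUnit_norm_sub_lt`).

For (ii), faithfulness bounds the dimension of a suitable element of `S` away from `0`, so (γ) and
(β) put a nonzero `p ∈ P` below any given `a > 0`, as `p = w* a w`
(`exists_ne_zero_eq_star_mul_mul`). Fullness of `p` yields simplicity; its infiniteness passes to
every hereditary subalgebra. -/

namespace CStarComparison

/-! ### Projections and Cuntz comparison. -/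

section Projections

variable {A : Type*} [CStarAlgebra A]

/-- Compressing by `p` gives `pmp ≥ (1 - r)p`, so `pmp` is invertible in the corner `pAp` and can be
normalised to `p` by its inverse square root. -/
theorem exists_star_mul_mul_eq [PartialOrder A] [StarOrderedRing A] {p m : A}
    (hp : IsStarProjection p) {r : ℝ} (hr0 : 0 ≤ r) (hr1 : r < 1)
    (h1 : p - m ≤ algebraMap ℝ A r) : ∃ w : A, star w * m * w = p := by
  have hpp : p * p = p := hp.isIdempotentElem
  have hps : star p = p := hp.isSelfAdjoint
  have h2 : p * (p - m) * p ≤ r • p := by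
    have := star_left_conjugate_le_conjugate h1 p
    rwa [hps, ← Algebra.commutes, mul_assoc _ p p, hpp, ← Algebra.smul_def] at this
  -- Adding `1 - p` replaces inversion in the corner by inversion in `A`; `t` commutes with `p`.
  set t := p * m * p + (1 - p) with ht
  have h3 : (1 - r) • (1 : A) ≤ t := by
    have e : t - (1 - r) • (1 : A) = (r • p - p * (p - m) * p) + r • (1 - p) := by
      rw [ht, mul_sub, sub_mul, hpp, hpp, sub_smul, one_smul, smul_sub]
      abel
    rw [← sub_nonneg, e]
    exact add_nonneg (sub_nonneg.mpr h2) (smul_nonneg hr0 hp.one_sub.nonneg)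
  have hst : IsStrictlyPositive t := by
    refine IsStrictlyPositive.of_le (a := (1 - r) • (1 : A)) ?_ h3
    exact IsStrictlyPositive.smul (by linarith) (by simp)
  have htp : p * t = t * p := by
    rw [ht]
    simp only [mul_add, add_mul, mul_sub, sub_mul, mul_one, one_mul, ← mul_assoc, hpp]
    simp only [mul_assoc, hpp]
  have htp' : t * p = p * m * p := by
    rw [ht]
    simp only [add_mul, sub_mul, one_mul, mul_assoc, hpp, sub_self, add_zero]
  set s := t ^ (-(1/2) : ℝ) with hs
  have hcomm : Commute s p := by
    have : Commute t p := htp.symm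
    exact this.cfc_nnreal _
  have hss : star s = s := (IsSelfAdjoint.of_nonneg CFC.rpow_nonneg).star_eq
  refine ⟨p * s, ?_⟩
  rw [star_mul, hss, hps]
  calc s * p * m * (p * s) = s * (p * m * p) * s := by simp only [mul_assoc]
    _ = s * t * s * p := by
      rw [← htp', ← mul_assoc, mul_assoc _ p s, ← hcomm.eq, ← mul_assoc]
    _ = p := by rw [hs, CFC.conjugate_rpow_neg_one_half t, one_mul]

/-- The range projection of a partial isometry. -/
theorem isStarProjection_mul_star_self {v p : A}
    (h : star v * v = p) (hv : v * p = v) : IsStarProjection (v * star v) := by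
  refine ⟨?_, IsSelfAdjoint.mul_star_self v⟩
  change v * star v * (v * star v) = v * star v
  rw [mul_assoc, ← mul_assoc (star v), h, ← mul_assoc, hv]

theorem mul_eq_self_of_star_mul_self_eq {v p : A} (hp : IsStarProjection p)
    (h : star v * v = p) : v * p = v := by
  have hpp : p * p = p := hp.isIdempotentElem
  have hps : star p = p := hp.isSelfAdjoint
  rw [← sub_eq_zero, ← CStarRing.star_mul_self_eq_zero_iff, star_sub, star_mul, hps, sub_mul,
    mul_sub, mul_sub, h, mul_assoc, ← mul_assoc (star v), h, hpp, hpp, mul_assoc, h, hpp]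
  simp

/-- A projection equivalent to an infinite projection is infinite. -/
theorem IsInfiniteProjection.of_equiv {p v : A} (hp : IsInfiniteProjection p)
    (h : star v * v = p) : IsInfiniteProjection (v * star v) := by
  obtain ⟨hproj, w, hw, hpw, hne⟩ := hp
  have hpp : p * p = p := hproj.isIdempotentElem
  have hps : star p = p := hproj.isSelfAdjoint
  have hv := mul_eq_self_of_star_mul_self_eq hproj h
  have hwp := mul_eq_self_of_star_mul_self_eq hproj hw
  have hpw' : p * w = w := by
    calc p * w = p * (w * (star w * w)) := by rw [hw, hwp]
      _ = p * (w * star w) * w := by simp only [mul_assoc]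
      _ = w * (star w * w) := by rw [hpw, mul_assoc]
      _ = w := by rw [hw, hwp]
  have hws' : star w * p = star w := by
    have := congrArg star hpw'
    rwa [star_mul, hps] at this
  have e : (v * w * star v) * star (v * w * star v) = v * (w * star w) * star v := by
    simp only [star_mul, star_star]
    calc _ = v * w * (star v * v) * star w * star v := by simp only [mul_assoc]
      _ = _ := by rw [h, mul_assoc v w p, hwp]; simp only [mul_assoc]
  refine ⟨isStarProjection_mul_star_self h hv, v * w * star v, ?_, ?_, ?_⟩
  · simp only [star_mul, star_star]
    calc _ = v * star w * (star v * v) * w * star v := by simp only [mul_assoc]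
      _ = v * (star w * p * w) * star v := by rw [h]; simp only [mul_assoc]
      _ = _ := by rw [hws', hw, hv]
  · rw [e]
    calc _ = v * (star v * v) * (w * star w) * star v := by simp only [mul_assoc]
      _ = _ := by rw [h, hv]
  · rw [e]
    intro hcon
    apply hne
    have := congrArg (fun x => star v * x * v) hcon
    calc w * star w = p * (w * star w) * p := by
          rw [hpw, mul_assoc, hws']
      _ = star v * (v * (w * star w) * star v) * v := by
          rw [← h]; simp only [mul_assoc]
      _ = star v * v * (star v * v) := by rw [this]; simp only [mul_assoc]
      _ = p := by rw [h, hpp]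

/-- A projection Cuntz below a positive element is equivalent to one orthogonal to everything
that the positive element is orthogonal to. -/
theorem CuntzLE.exists_orthogonal [PartialOrder A] [StarOrderedRing A] {p e b c : A}
    (hp : IsStarProjection p) (he : 0 ≤ e) (hb : IsSelfAdjoint b) (hbe : b * e = 0)
    (hpe : CuntzLE p e) (hcp : CuntzLE c p) :
    ∃ q : A, IsStarProjection q ∧ q * b = 0 ∧ CuntzLE c q := by
  obtain ⟨x, hx⟩ := hpe
  obtain ⟨n, hn⟩ := (hx.eventually_lt_const one_pos).exists
  have hxs : IsSelfAdjoint (x n * e * star (x n)) :=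
    (star_right_conjugate_nonneg he (x n)).isSelfAdjoint
  obtain ⟨w, hw⟩ := exists_star_mul_mul_eq hp (norm_nonneg _) hn
    (hp.isSelfAdjoint.sub hxs).le_algebraMap_norm_self
  have hpp : p * p = p := hp.isIdempotentElem
  set d := CFC.sqrt e with hd
  have hdd : d * d = e := CFC.sqrt_mul_sqrt_self e
  have hds : star d = d := (CFC.sqrt_nonneg e).isSelfAdjoint
  have hdb : d * b = 0 := by
    rw [← CStarRing.star_mul_self_eq_zero_iff, star_mul, hds, hb.star_eq, mul_assoc,
      ← mul_assoc d, hdd, ← mul_assoc, hbe, zero_mul]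
  -- The left factor `d = e^{1/2}` puts the range of `v` where `b` vanishes, while `v* v = w* (xₙ e
  -- xₙ*) w = p`.
  set v := d * star (x n) * w with hv
  have hvv : star v * v = p := by
    rw [← hw, ← hdd, hv]
    simp only [star_mul, star_star, hds, mul_assoc]
  refine ⟨v * star v, isStarProjection_mul_star_self hvv
    (mul_eq_self_of_star_mul_self_eq hp hvv), ?_, ?_⟩
  · rw [hv]
    simp only [star_mul, star_star, hds, mul_assoc, hdb, mul_zero]
  · obtain ⟨y, hy⟩ := hcp
    refine ⟨fun n => y n * star v, hy.congr fun n => ?_⟩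
    congr 2
    calc y n * p * star (y n) = y n * (star v * v) * (star v * v) * star (y n) := by
          rw [hvv, mul_assoc (y n) p p, hpp]
      _ = _ := by simp only [star_mul, star_star, mul_assoc]

end Projections

/-! ### Stable rank one and density of the invertibles. -/

section StableRank

variable {A : Type*} [CStarAlgebra A]

theorem dense_isUnit_of_stableRank_eq_one (h : stableRank A = 1) : Dense {a : A | IsUnit a} := by
  have h1 : Dense {a : Fin 1 → A | ∃ b : Fin 1 → A, ∑ i, b i * a i = 1} := by
    by_contra hcon
    have : (2 : ℕ∞) ≤ stableRank A := by
      refine le_iInf₂ fun n hn => ?_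
      obtain ⟨hn1, hn2⟩ := hn
      have : n ≠ 1 := by rintro rfl; exact hcon hn2
      exact_mod_cast (show 2 ≤ n by omega)
    rw [h] at this
    exact absurd this (by norm_num)
  have h2 : Dense {a : A | ∃ b : A, b * a = 1} := by
    intro a
    rw [Metric.mem_closure_iff]
    intro ε hε
    obtain ⟨x, ⟨b, hb⟩, hx⟩ := Metric.mem_closure_iff.mp (h1 fun _ => a) ε hε
    exact ⟨x 0, ⟨b 0, by simpa using hb⟩, (dist_le_pi_dist _ _ 0).trans_lt hx⟩
  refine h2.mono ?_
  rintro x ⟨y, hyx⟩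
  -- Left invertibles are dense, so `y` can be replaced by a left invertible `y'` with `y' x` still
  -- invertible. Then `y'` is invertible on both sides, hence so is `x`.
  have hopen : IsOpen {y : A | IsUnit (y * x)} :=
    Units.isOpen.preimage (continuous_mul_const x)
  obtain ⟨y', hy', z, hz⟩ := h2.inter_open_nonempty _ hopen ⟨y, by simp [hyx]⟩
  obtain ⟨g, hg⟩ := hy'
  have hr : y' * (x * ↑g⁻¹) = 1 := by rw [← mul_assoc, ← hg, Units.mul_inv]
  have hu : IsUnit y' := isUnit_iff_exists.mpr
    ⟨x * ↑g⁻¹, hr, by rwa [left_inv_eq_right_inv hz hr] at hz⟩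
  obtain ⟨k, rfl⟩ := hu
  refine ⟨k⁻¹ * g, ?_⟩
  rw [Units.val_mul, hg, Units.inv_mul_cancel_left]

end StableRank

end CStarComparison

namespace CStarComparison

/-! ### Rotating a projection by polar parts of invertibles. -/

section Polar

variable {A : Type*} [CStarAlgebra A]

theorem exists_unitary_mul_abs_eq [PartialOrder A] [StarOrderedRing A] {z : A} (hz : IsUnit z) :
    ∃ u ∈ unitary A, u * CFC.abs z = z := by
  have hg : IsUnit (CFC.abs z) :=
    (CFC.isUnit_sqrt_iff _ (star_mul_self_nonneg z)).mpr (hz.star.mul hz)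
  obtain ⟨g, hg⟩ := hg
  have hgs : star (g : A) = g := by rw [hg]; exact (CFC.abs_nonneg z).isSelfAdjoint.star_eq
  have hgs' : star (↑g⁻¹ : A) = ↑g⁻¹ := by
    rw [← Units.coe_star_inv]
    congr 2
    exact Units.ext hgs
  have h1 : star (z * ↑g⁻¹) * (z * ↑g⁻¹) = 1 := by
    rw [star_mul, hgs', mul_assoc, ← mul_assoc (star z), ← CFC.abs_mul_abs, ← hg]
    simp
  have h2 : IsUnit (z * ↑g⁻¹) := hz.mul g⁻¹.isUnit
  refine ⟨z * ↑g⁻¹, Unitary.mem_iff.mpr ⟨h1, ?_⟩, by rw [← hg]; simp⟩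
  exact h2.mul_right_cancel (by rw [mul_assoc, h1, mul_one, one_mul])

theorem tendsto_zero_of_star_mul_self {ι : Type*} {l : Filter ι} {f : ι → A}
    (h : Tendsto (fun i => star (f i) * f i) l (𝓝 0)) : Tendsto f l (𝓝 0) := by
  rw [tendsto_zero_iff_norm_tendsto_zero] at h ⊢
  simp only [CStarRing.norm_star_mul_self] at h
  have := h.sqrt
  simpa [Real.sqrt_mul_self] using this

/-- Put `X = p xₙ*`, so `X* X → c²`. Approximating `X + b` by invertibles gives unitaries `u` with
`u(c + b) ≈ X + b`. Multiplying by `c` shows that `u c² ≈ X c` lies in the range of `p`; multiplying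
by `b` shows that `u b² ≈ b²` is killed by `p`. So `u* p u` works. -/
theorem exists_isStarProjection_norm_mul_lt [PartialOrder A] [StarOrderedRing A]
    (hd : Dense {a : A | IsUnit a}) {p b c : A} (hp : IsStarProjection p) (hb : 0 ≤ b)
    (hc : 0 ≤ c) (hbc : b * c = 0) (hpb : p * b = 0) (h : CuntzLE (c * c) p)
    {δ : ℝ} (hδ : 0 < δ) :
    ∃ q : A, IsStarProjection q ∧ ‖q * b‖ < δ ∧ ‖(1 - q) * c‖ < δ := by
  obtain ⟨x, hx⟩ := h
  have hpp : p * p = p := hp.isIdempotentElem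
  have hps : star p = p := hp.isSelfAdjoint
  have hbs : star b = b := hb.isSelfAdjoint
  have hcs : star c = c := hc.isSelfAdjoint
  have hcb : c * b = 0 := by simpa [hbs, hcs] using congrArg star hbc
  have hbp : b * p = 0 := by simpa [hbs, hps] using congrArg star hpb
  set X : ℕ → A := fun n => p * star (x n) with hXdef
  have hpX : ∀ n, p * X n = X n := fun n => by rw [hXdef, ← mul_assoc, hpp]
  have hbX : ∀ n, b * X n = 0 := fun n => by rw [hXdef, ← mul_assoc, hbp, zero_mul]
  have hXb : ∀ n, star (X n) * b = 0 := fun n => by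
    simpa [hbs] using congrArg star (hbX n)
  have hX : Tendsto (fun n => star (X n) * X n) atTop (𝓝 (c * c)) := by
    rw [← sub_zero (c * c)]
    have := tendsto_const_nhds (x := c * c) (f := atTop (α := ℕ)) |>.sub
      (tendsto_zero_iff_norm_tendsto_zero.mpr hx)
    refine this.congr fun n => ?_
    rw [sub_sub_cancel]
    simp only [hXdef, star_mul, star_star, hps]
    simp only [mul_assoc]
    rw [← mul_assoc p p, hpp]
  -- `b X = 0` is exact, but `X b` is only small: `(X b)* (X b) → b c² b = 0`.
  have hXb0 : Tendsto (fun n => X n * b) atTop (𝓝 0) := by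
    refine tendsto_zero_of_star_mul_self ?_
    have h1 := (hX.const_mul b).mul_const b
    rw [mul_assoc, mul_assoc, hcb, mul_zero, mul_zero] at h1
    refine h1.congr fun n => ?_
    simp only [star_mul, hbs, mul_assoc]
  set y : ℕ → A := fun n => X n + b with hy
  have hyy : Tendsto (fun n => star (y n) * y n) atTop (𝓝 ((c + b) * (c + b))) := by
    have h1 := hX.add_const (b * b)
    have e : (c + b) * (c + b) = c * c + b * b := by
      rw [add_mul, mul_add, mul_add, hcb, hbc]; abel
    rw [e]
    refine h1.congr fun n => ?_
    simp only [hy, star_add, hbs, add_mul, mul_add, hXb, hbX]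
    abel
  have hz : ∀ n : ℕ, ∃ z : A, IsUnit z ∧ ‖z - y n‖ < 1 / ((n : ℝ) + 1) ∧
      ‖star z * z - star (y n) * y n‖ < 1 / ((n : ℝ) + 1) := by
    intro n
    have hopen : IsOpen {z : A | ‖z - y n‖ < 1 / ((n : ℝ) + 1) ∧
        ‖star z * z - star (y n) * y n‖ < 1 / ((n : ℝ) + 1)} :=
      IsOpen.inter
        (isOpen_lt (f := fun z : A => ‖z - y n‖) (by fun_prop) continuous_const)
        (isOpen_lt (f := fun z : A => ‖star z * z - star (y n) * y n‖) (by fun_prop)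
          continuous_const)
    have hpos : 0 < 1 / ((n : ℝ) + 1) := by positivity
    obtain ⟨z, hz, hzu⟩ := hd.inter_open_nonempty _ hopen ⟨y n, by simpa using hpos⟩
    exact ⟨z, hzu, hz⟩
  choose z hzu hzy hzz using hz
  have hzy0 : Tendsto (fun n => z n - y n) atTop (𝓝 0) :=
    squeeze_zero_norm (fun n => (hzy n).le) tendsto_one_div_add_atTop_nhds_zero_nat
  have hzz0 : Tendsto (fun n => star (z n) * z n) atTop (𝓝 ((c + b) * (c + b))) := by
    have h1 : Tendsto (fun n => star (z n) * z n - star (y n) * y n) atTop (𝓝 0) :=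
      squeeze_zero_norm (fun n => (hzz n).le) tendsto_one_div_add_atTop_nhds_zero_nat
    simpa using h1.add hyy
  have habs : Tendsto (fun n => CFC.abs (z n)) atTop (𝓝 (c + b)) := by
    have hcb0 : 0 ≤ c + b := add_nonneg hc hb
    have h0 : 0 ≤ (c + b) * (c + b) := by
      have := star_mul_self_nonneg (c + b)
      rwa [hcb0.isSelfAdjoint.star_eq] at this
    have h1 := (CFC.continuousOn_sqrt (A := A) _ h0).tendsto
    rw [CFC.sqrt_mul_self (c + b)] at h1
    exact h1.comp (tendsto_nhdsWithin_iff.mpr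
      ⟨hzz0, Eventually.of_forall fun n => star_mul_self_nonneg (z n)⟩)
  choose u huu hu using fun n => exists_unitary_mul_abs_eq (hzu n)
  have hmain : Tendsto (fun n => u n * (c + b) - y n) atTop (𝓝 0) := by
    have h1 : Tendsto (fun n => u n * (c + b - CFC.abs (z n))) atTop (𝓝 0) := by
      rw [tendsto_zero_iff_norm_tendsto_zero]
      simp only [fun n => CStarRing.norm_mem_unitary_mul (c + b - CFC.abs (z n)) (huu n)]
      rw [← tendsto_zero_iff_norm_tendsto_zero]
      simpa using habs.const_sub (c + b)
    have h2 := h1.add hzy0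
    rw [add_zero] at h2
    refine h2.congr fun n => ?_
    rw [mul_sub, hu]
    abel
  have hB : Tendsto (fun n => p * u n * (b * b)) atTop (𝓝 0) := by
    have h1 := ((hmain.mul_const b).const_mul p).add hXb0
    simp only [zero_mul, mul_zero, add_zero] at h1
    refine h1.congr fun n => ?_
    have e : (u n * (c + b) - y n) * b = u n * (b * b) - X n * b - b * b := by
      simp only [hy, sub_mul, add_mul, mul_add, mul_assoc, hcb, mul_zero, zero_add]
      abel
    rw [e, mul_sub, mul_sub, ← mul_assoc p b, hpb, zero_mul, ← mul_assoc p (X n), hpX,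
      ← mul_assoc p (u n)]
    abel
  have hC : Tendsto (fun n => (1 - p) * u n * (c * c)) atTop (𝓝 0) := by
    have h1 := ((hmain.mul_const c).const_mul (1 - p))
    simp only [zero_mul, mul_zero] at h1
    refine h1.congr fun n => ?_
    have e : (u n * (c + b) - y n) * c = u n * (c * c) - X n * c := by
      simp only [hy, sub_mul, add_mul, mul_add, mul_assoc, hbc, mul_zero, add_zero]
    have e2 : (1 - p) * (X n * c) = 0 := by
      rw [← mul_assoc, sub_mul, hpX, one_mul, sub_self, zero_mul]
    rw [e, mul_sub, e2, sub_zero, mul_assoc]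
  have hconj : ∀ n, ∀ r : A, IsStarProjection r → IsStarProjection (star (u n) * r * u n) := by
    intro n r hr
    have huu' := (Unitary.mem_iff.mp (huu n)).2
    refine ⟨?_, ?_⟩
    · change _ * _ = _
      calc _ = star (u n) * r * (u n * star (u n)) * r * u n := by simp only [mul_assoc]
        _ = star (u n) * (r * r) * u n := by rw [huu', mul_one]; simp only [mul_assoc]
        _ = _ := by rw [hr.isIdempotentElem.eq]
    · change star _ = _
      -- Unitarity of `u` is not needed for self-adjointness.
      simp [mul_assoc, hr.isSelfAdjoint.star_eq]
  -- The estimates concern `s²`; `‖q s‖² = ‖q s² q‖` converts a bound `δ²` there into `δ` for `s`.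
  have key : ∀ n, ∀ r s : A, IsStarProjection r → star s = s →
      ‖r * u n * (s * s)‖ < δ ^ 2 → ‖star (u n) * r * u n * s‖ < δ := by
    intro n r s hr hs hlt
    have hq := hconj n r hr
    set q := star (u n) * r * u n with hqdef
    have h1 : ‖q * s‖ * ‖q * s‖ ≤ ‖r * u n * (s * s)‖ := by
      rw [← CStarRing.norm_self_mul_star, star_mul, hs, hq.isSelfAdjoint.star_eq]
      have e : q * s * (s * q) = star (u n) * (r * u n * (s * s)) * q := by
        rw [hqdef]; simp only [mul_assoc]
      rw [e]
      calc _ ≤ ‖star (u n) * (r * u n * (s * s))‖ * ‖q‖ := norm_mul_le _ _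
        _ ≤ ‖star (u n) * (r * u n * (s * s))‖ * 1 := by
          gcongr; exact hq.norm_le
        _ = _ := by
          rw [mul_one, CStarRing.norm_mem_unitary_mul _ (Unitary.star_mem (huu n))]
    exact lt_of_pow_lt_pow_left₀ 2 hδ.le (by rw [pow_two]; exact h1.trans_lt hlt)
  have hδ2 : 0 < δ ^ 2 := by positivity
  have hBe := (tendsto_zero_iff_norm_tendsto_zero.mp hB).eventually_lt_const hδ2
  have hCe := (tendsto_zero_iff_norm_tendsto_zero.mp hC).eventually_lt_const hδ2
  obtain ⟨n, hn1, hn2⟩ := (hBe.and hCe).exists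
  have h1u := (Unitary.mem_iff.mp (huu n)).1
  refine ⟨star (u n) * p * u n, hconj n p hp, key n p b hp hbs hn1, ?_⟩
  have := key n (1 - p) c hp.one_sub hcs hn2
  rwa [mul_sub, sub_mul, mul_one, h1u] at this

/-- Relative to `q` and `r = 1 - q`, the off-diagonal parts and the wrong blocks of `c - b` are
small. Multiplying `w` by the symmetry `q - r` gives `qcq + rbr + η ≥ η`, so `w` is invertible. -/
theorem exists_isUnit_norm_sub_lt [PartialOrder A] [StarOrderedRing A]
    (hd : Dense {a : A | IsUnit a}) {p b c : A} (hp : IsStarProjection p) (hb : 0 ≤ b)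
    (hc : 0 ≤ c) (hbc : b * c = 0) (hpb : p * b = 0) (h : CuntzLE (c * c) p)
    {ε : ℝ} (hε : 0 < ε) :
    ∃ w : A, IsSelfAdjoint w ∧ IsUnit w ∧ ‖c - b - w‖ < ε := by
  obtain ⟨q, hq, hqb, hqc⟩ :=
    exists_isStarProjection_norm_mul_lt hd hp hb hc hbc hpb h (δ := ε / 8) (by positivity)
  obtain ⟨r, hr⟩ : ∃ r, r = 1 - q := ⟨_, rfl⟩
  rw [← hr] at hqc
  have hrp : IsStarProjection r := hr ▸ hq.one_sub
  have hqq : q * q = q := hq.isIdempotentElem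
  have hrr : r * r = r := hrp.isIdempotentElem
  have hqr : q * r = 0 := by rw [hr, mul_sub, mul_one, hqq, sub_self]
  have hrq : r * q = 0 := by rw [hr, sub_mul, one_mul, hqq, sub_self]
  have hqs : star q = q := hq.isSelfAdjoint
  have hrs : star r = r := hrp.isSelfAdjoint
  have hcs : star c = c := hc.isSelfAdjoint
  have hbs : star b = b := hb.isSelfAdjoint
  have hq1 := hq.norm_le
  have hr1 := hrp.norm_le
  set η := ε / 4 with hη
  have hη0 : 0 < η := by positivity
  set w := q * c * q - r * b * r + η • (q - r) with hw
  have hsq : (q - r) * (q - r) = 1 := by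
    rw [sub_mul, mul_sub, mul_sub, hqq, hqr, hrq, hrr, hr]; abel
  have hws : w * (q - r) = q * c * q + r * b * r + η • 1 := by
    rw [hw, add_mul, smul_mul_assoc, hsq, sub_mul, mul_sub, mul_sub, mul_assoc _ q q, hqq,
      mul_assoc _ q r, hqr, mul_assoc _ r q, hrq, mul_assoc _ r r, hrr]
    simp
  have hpos : IsUnit (w * (q - r)) := by
    rw [hws]
    refine CStarAlgebra.isUnit_of_le (η • (1 : A)) ?_ ?_
    · refine le_add_of_nonneg_left (add_nonneg ?_ ?_)
      · simpa [hqs] using star_left_conjugate_nonneg hc q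
      · simpa [hrs] using star_left_conjugate_nonneg hb r
    · exact IsStrictlyPositive.smul hη0 (by simp)
  refine ⟨w, ?_, ?_, ?_⟩
  · change star w = w
    simp [hw, hqs, hrs, hcs, hbs, mul_assoc]
  · have hu : IsUnit (q - r) := isUnit_iff_exists.mpr ⟨q - r, hsq, hsq⟩
    have := hpos.mul hu
    rwa [mul_assoc, hsq, mul_one] at this
  · have hcr : ‖c * r‖ < ε / 8 := by
      rw [← norm_star, star_mul, hcs, hrs]; exact hqc
    have hbq : ‖b * q‖ < ε / 8 := by
      rw [← norm_star, star_mul, hbs, hqs]; exact hqb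
    have e1 : c - q * c * q = r * c + q * (c * r) := by
      rw [hr]; noncomm_ring
    have e2 : b - r * b * r = q * b + r * (b * q) := by
      rw [hr]; noncomm_ring
    have e : c - b - w = (r * c + q * (c * r)) - (q * b + r * (b * q)) - η • (q - r) := by
      rw [← e1, ← e2, hw]; abel
    have hqcr : ‖q * (c * r)‖ < ε / 8 := (norm_mul_le _ _).trans_lt
      ((mul_le_of_le_one_left (norm_nonneg _) hq1).trans_lt hcr)
    have hrbq : ‖r * (b * q)‖ < ε / 8 := (norm_mul_le _ _).trans_lt
      ((mul_le_of_le_one_left (norm_nonneg _) hr1).trans_lt hbq)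
    have hs1 : ‖η • (q - r)‖ ≤ η * 1 := by
      rw [norm_smul, Real.norm_of_nonneg hη0.le]
      gcongr
      have h1 : ‖q - r‖ * ‖q - r‖ = ‖(1 : A)‖ := by
        rw [← CStarRing.norm_star_mul_self, star_sub, hqs, hrs, hsq]
      have h2 := (IsStarProjection.one A).norm_le
      nlinarith [norm_nonneg (q - r)]
    rw [e]
    have := norm_sub_le (r * c + q * (c * r) - (q * b + r * (b * q))) (η • (q - r))
    have := norm_sub_le (r * c + q * (c * r)) (q * b + r * (b * q))
    have := norm_add_le (r * c) (q * (c * r))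
    have := norm_add_le (q * b) (r * (b * q))
    linarith

end Polar

end CStarComparison

namespace CStarComparison

/-! ### The strict order on `Aff Q` and uniform approximation. -/

section AffOrder

variable {E : Type*} [AddCommGroup E] [Module ℝ E] [TopologicalSpace E] {Q : Set E}

/-- Nonemptiness excludes `f = g`, for which the pointwise condition could otherwise hold vacuously.
-/
theorem Aff.lt_iff (hQ : Q.Nonempty) {f g : Aff Q} : f < g ↔ ∀ x, f x < g x := by
  constructor
  · intro h x
    rcases h.le with h' | h'
    · exact absurd (sub_eq_zero.mp h').symm h.ne
    · exact sub_pos.mp (h' x)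
  · intro h
    refine lt_of_le_of_ne (Or.inr fun x => sub_pos.mpr (h x)) ?_
    rintro rfl
    obtain ⟨x, hx⟩ := hQ
    exact lt_irrefl _ (h ⟨x, hx⟩)

instance : OrderTopology (Aff Q) := ⟨rfl⟩

/-- An element of the closure of a subset of `Aff Q` is uniformly approximated by that subset. -/
theorem Aff.exists_abs_sub_lt (hQ : Q.Nonempty) {f : Aff Q} {T : Set (Aff Q)}
    (hf : f ∈ closure T) {δ : ℝ} (hδ : 0 < δ) : ∃ g ∈ T, ∀ x, |g x - f x| < δ := by
  have h1 : f - δ • (1 : Aff Q) < f := (Aff.lt_iff hQ).mpr fun x => by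
    change f x - δ * 1 < f x
    linarith
  have h2 : f < f + δ • (1 : Aff Q) := (Aff.lt_iff hQ).mpr fun x => by
    change f x < f x + δ * 1
    linarith
  obtain ⟨g, ⟨hg1, hg2⟩, hgT⟩ := mem_closure_iff.mp hf _
    (isOpen_Ioo' (f - δ • (1 : Aff Q)) (f + δ • (1 : Aff Q))) ⟨h1, h2⟩
  refine ⟨g, hgT, fun x => abs_lt.mpr ?_⟩
  have h3 : f x - δ * 1 < g x := (Aff.lt_iff hQ).mp hg1 x
  have h4 : g x < f x + δ * 1 := (Aff.lt_iff hQ).mp hg2 x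
  constructor <;> linarith

end AffOrder

section FEps

theorem fEps_le_one (ε t : ℝ) : fEps ε t ≤ 1 := max_le zero_le_one (min_le_left _ _)

theorem fEps_nonneg (ε t : ℝ) : 0 ≤ fEps ε t := le_max_left _ _

theorem fEps_zero (ε : ℝ) : fEps ε 0 = 0 := by simp [fEps]

theorem fEps_eq_one {ε t : ℝ} (hε : 0 < ε) (h : ε ≤ t) : fEps ε t = 1 := by
  have : 1 ≤ 2 * t / ε - 1 := by
    rw [le_sub_iff_add_le, le_div_iff₀ hε]
    linarith
  simp [fEps, min_eq_left this]

end FEps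

/-! ### Functional calculus and estimates of `D_φ`. -/

section StateEstimates

variable {A : Type*} [CStarAlgebra A]

theorem cfc_ne_zero {a : A} (ha : IsSelfAdjoint a) {f : ℝ → ℝ} (hf : Continuous f) {t : ℝ}
    (ht : t ∈ spectrum ℝ a) (hft : f t ≠ 0) : cfc f a ≠ 0 := by
  intro h
  rw [← cfc_zero ℝ a] at h
  exact hft (eqOn_of_cfc_eq_cfc h hf.continuousOn continuousOn_const ha ht)

theorem ClosedUnderCFC.cfc_mem {S : NonUnitalStarSubalgebra ℂ A} (hS : ClosedUnderCFC S) {a : A}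
    (haS : a ∈ S) (ha : IsSelfAdjoint a) {f : ℝ → ℝ} (hf : Continuous f) : cfc f a ∈ S := by
  rw [cfc_real_eq_complex]
  exact hS a haS ha.isStarNormal _ (by fun_prop)

theorem exists_isSelfAdjoint_mem_norm_sub_lt {S : NonUnitalStarSubalgebra ℂ A}
    (hS : Dense (S : Set A)) {a : A} (ha : IsSelfAdjoint a) {ε : ℝ} (hε : 0 < ε) :
    ∃ b ∈ S, IsSelfAdjoint b ∧ ‖a - b‖ < ε := by
  obtain ⟨s, hs, hd⟩ := Metric.mem_closure_iff.mp (hS a) ε hε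
  rw [dist_eq_norm] at hd
  refine ⟨(realPart s : A), ?_, (realPart s).2, ?_⟩
  · rw [realPart_apply_coe, ← Complex.coe_smul]
    exact SMulMemClass.smul_mem _ (add_mem hs (star_mem hs))
  · have h1 : (realPart (a - s) : A) = a - realPart s := by
      rw [map_sub, AddSubgroupClass.coe_sub, ha.coe_realPart]
    rw [← h1]
    exact (realPart.norm_le _).trans_lt hd

theorem cfc_fEps_cfc {a : A} (ha : IsSelfAdjoint a) {g : ℝ → ℝ} (hg : Continuous g) (ε : ℝ) :
    cfc (fEps ε) (cfc g a) = cfc (fun t => fEps ε (g t)) a :=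
  (cfc_comp' (fEps ε) g a (continuous_fEps ε).continuousOn hg.continuousOn).symm

variable [PartialOrder A]

theorem IsState.re_nonneg {φ : WeakDual ℂ A} (hφ : IsState φ) {a : A} (ha : 0 ≤ a) :
    0 ≤ (φ a).re :=
  (Complex.le_def.mp (hφ.nonneg a ha)).1

/-- Evaluation at `a` attains its minimum on the compact set `Q`, so pointwise faithfulness becomes
a uniform bound. -/
theorem exists_pos_le_re {Q : Set (WeakDual ℂ A)} (hQ : ∀ φ ∈ Q, IsState φ)
    (hne : Q.Nonempty) (hc : IsCompact Q) {S : NonUnitalStarSubalgebra ℂ A}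
    (hf : ∀ φ ∈ Q, IsFaithfulOn φ S) {a : A} (haS : a ∈ S) (ha : 0 ≤ a) (ha0 : a ≠ 0) :
    ∃ δ > 0, ∀ φ ∈ Q, δ ≤ (φ a).re := by
  have hcont : Continuous fun φ : WeakDual ℂ A => (φ a).re :=
    Complex.continuous_re.comp (WeakDual.eval_continuous a)
  obtain ⟨ψ, hψ, hmin⟩ := hc.exists_isMinOn hne hcont.continuousOn
  refine ⟨(ψ a).re, ?_, fun φ hφ => hmin hφ⟩
  refine lt_of_le_of_ne ((hQ ψ hψ).re_nonneg ha) fun h => ha0 (hf ψ hψ a haS ha ?_)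
  exact Complex.ext h.symm (Complex.le_def.mp ((hQ ψ hψ).nonneg a ha)).2.symm

variable [StarOrderedRing A]

theorem IsState.re_mono {φ : WeakDual ℂ A} (hφ : IsState φ) {a b : A} (h : a ≤ b) :
    (φ a).re ≤ (φ b).re := by
  have := hφ.re_nonneg (sub_nonneg.mpr h)
  rw [map_sub, Complex.sub_re] at this
  linarith

theorem dimFn_cfc_le {φ : WeakDual ℂ A} (hφ : IsState φ) {a : A} (ha : IsSelfAdjoint a)
    {g h : ℝ → ℝ} (hg : Continuous g) (hh : Continuous h) (hg0 : ∀ t, 0 ≤ g t)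
    (hle : ∀ ε t, fEps ε (g t) ≤ h t) : dimFn φ (cfc g a) ≤ (φ (cfc h a)).re := by
  refine le_of_tendsto (tendsto_dimFn hφ (cfc_nonneg fun t _ => hg0 t))
    (Eventually.of_forall fun ε => hφ.re_mono ?_)
  rw [cfc_fEps_cfc ha hg]
  exact cfc_mono (fun t _ => hle ε t) ((continuous_fEps ε).comp hg).continuousOn hh.continuousOn

/-- Only small `ε` matter in the limit, so the pointwise bound is required just for `ε ≤ r`. -/
theorem le_dimFn_cfc {φ : WeakDual ℂ A} (hφ : IsState φ) {a : A} (ha : IsSelfAdjoint a)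
    {g h : ℝ → ℝ} (hg : Continuous g) (hh : Continuous h) (hg0 : ∀ t, 0 ≤ g t) {r : ℝ}
    (hr : 0 < r) (hle : ∀ ε t, 0 < ε → ε ≤ r → h t ≤ fEps ε (g t)) :
    (φ (cfc h a)).re ≤ dimFn φ (cfc g a) := by
  refine ge_of_tendsto (tendsto_dimFn hφ (cfc_nonneg fun t _ => hg0 t)) ?_
  filter_upwards [Ioc_mem_nhdsGT hr] with ε hε
  refine hφ.re_mono ?_
  rw [cfc_fEps_cfc ha hg]
  exact cfc_mono (fun t _ => hle ε t hε.1 hε.2) hh.continuousOn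
    ((continuous_fEps ε).comp hg).continuousOn

end StateEstimates

end CStarComparison

namespace CStarComparison

variable {A : Type*} [CStarAlgebra A] [PartialOrder A] [StarOrderedRing A]

/-! ### Real rank zero. -/

section RealRank

/-- The function of height at most `1` that is positive exactly on `(s - r, s + r)`. -/
noncomputable def bump (s r t : ℝ) : ℝ := max 0 (min 1 (r - |t - s|))

theorem continuous_bump (s r : ℝ) : Continuous (bump s r) := by
  unfold bump
  fun_prop

theorem bump_nonneg (s r t : ℝ) : 0 ≤ bump s r t := le_max_left _ _

theorem bump_le_one (s r t : ℝ) : bump s r t ≤ 1 := max_le zero_le_one (min_le_left _ _)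

theorem bump_eq_zero {s r t : ℝ} (h : r ≤ |t - s|) : bump s r t = 0 :=
  max_eq_left ((min_le_right _ _).trans (by linarith))

theorem bump_self_ne_zero (s : ℝ) {r : ℝ} (hr : 0 < r) : bump s r s ≠ 0 := by
  have : 0 < bump s r s := lt_max_of_lt_right (lt_min one_pos (by simpa using hr))
  exact this.ne'

/-- The function that is `0` on `(-∞, -η]`, linear on `[-η, η]` and `1` on `[η, ∞)`. -/
noncomputable def ramp (η t : ℝ) : ℝ := max 0 (min 1 ((t + η) / (2 * η)))

theorem continuous_ramp (η : ℝ) : Continuous (ramp η) := by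
  unfold ramp
  fun_prop

theorem ramp_nonneg (η t : ℝ) : 0 ≤ ramp η t := le_max_left _ _

theorem ramp_le_one (η t : ℝ) : ramp η t ≤ 1 := max_le zero_le_one (min_le_left _ _)

theorem ramp_eq_one {η t : ℝ} (hη : 0 < η) (h : η ≤ t) : ramp η t = 1 := by
  have : 1 ≤ (t + η) / (2 * η) := by
    rw [le_div_iff₀ (by positivity)]
    linarith
  simp [ramp, min_eq_left this]

theorem ramp_eq_zero {η t : ℝ} (hη : 0 < η) (h : t ≤ -η) : ramp η t = 0 :=
  max_eq_left ((min_le_right _ _).trans (div_nonpos_of_nonpos_of_nonneg (by linarith)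
    (by positivity)))

/-- The bump sits in `[η, 2η]`, where the ramp is already `1` and the left side is still `0`. -/
theorem fEps_sq_le_ramp_sub_bump {η : ℝ} (hη : 0 < η) (ε t : ℝ) :
    fEps ε (max (t - 2 * η) 0 ^ 2) ≤ ramp η t - bump (3 * η / 2) (η / 4) t := by
  rcases le_or_gt t (2 * η) with h | h
  · rw [max_eq_right (by linarith), zero_pow two_ne_zero, fEps_zero]
    rcases le_or_gt η t with h' | h'
    · rw [ramp_eq_one hη h']
      linarith [bump_le_one (3 * η / 2) (η / 4) t]
    · rw [bump_eq_zero (le_abs.mpr (Or.inr (by linarith)))]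
      linarith [ramp_nonneg η t]
  · rw [bump_eq_zero (le_abs.mpr (Or.inl (by linarith))), ramp_eq_one hη (by linarith)]
    linarith [fEps_le_one ε (max (t - 2 * η) 0 ^ 2)]

/-- The left side vanishes for `t ≤ -7η/4`; beyond that `t + 2η ≥ η/4 ≥ ε`, so the right side is
`1`. -/
theorem ramp_add_bump_le_fEps {η : ℝ} (hη : 0 < η) {ε : ℝ} (hε : 0 < ε) (hεη : ε ≤ η / 4)
    (t : ℝ) : ramp η t + bump (-(3 * η / 2)) (η / 4) t ≤ fEps ε (max (t + 2 * η) 0) := by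
  rcases le_or_gt (ε - 2 * η) t with h | h
  · rw [fEps_eq_one hε (le_max_of_le_left (by linarith))]
    rcases le_or_gt t (-η) with h' | h'
    · rw [ramp_eq_zero hη h', zero_add]
      exact bump_le_one _ _ _
    · rw [bump_eq_zero (le_abs.mpr (Or.inl (by linarith))), add_zero]
      exact ramp_le_one _ _
  · rw [bump_eq_zero (le_abs.mpr (Or.inr (by linarith))), ramp_eq_zero hη (by linarith), add_zero]
    exact fEps_nonneg _ _

variable {Q : Set (WeakDual ℂ A)} {P : Set A} {S : NonUnitalStarSubalgebra ℂ A}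

/-- The spectral points make both bumps of `a` nonzero, hence uniformly positive on `Q`. The ramp of
`a` thus has gaps `δ₁` and `δ₂` to the two dimensions, and approximating it within their minimum
suffices. -/
theorem exists_interpolating_projection (hQ_state : ∀ φ ∈ Q, IsState φ) (hQ_nonempty : Q.Nonempty)
    (hQ_compact : IsCompact Q) (hS_cfc : ClosedUnderCFC S)
    (h_faithful : ∀ φ ∈ Q, IsFaithfulOn φ S)
    (h_gamma : Set.Icc (0 : Aff Q) 1 ⊆ closure (affHat Q '' P))
    {a : A} (haS : a ∈ S) (ha : IsSelfAdjoint a) {η : ℝ} (hη : 0 < η)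
    (h1 : 3 * η / 2 ∈ spectrum ℝ a) (h2 : -(3 * η / 2) ∈ spectrum ℝ a) :
    ∃ p ∈ P, ∀ φ ∈ Q, dimFn φ (cfc (fun t => max (t - 2 * η) 0 ^ 2) a) < (φ p).re ∧
      (φ p).re < dimFn φ (cfc (fun t => max (t + 2 * η) 0) a) := by
  have hη4 : 0 < η / 4 := by positivity
  have hb : ∀ s ∈ spectrum ℝ a, ∃ δ > 0, ∀ φ ∈ Q, δ ≤ (φ (cfc (bump s (η / 4)) a)).re :=
    fun s hs => exists_pos_le_re hQ_state hQ_nonempty hQ_compact h_faithful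
      (hS_cfc.cfc_mem haS ha (continuous_bump _ _)) (cfc_nonneg fun t _ => bump_nonneg _ _ t)
      (cfc_ne_zero ha (continuous_bump _ _) hs (bump_self_ne_zero s hη4))
  obtain ⟨δ₁, hδ₁, hφ₁⟩ := hb _ h1
  obtain ⟨δ₂, hδ₂, hφ₂⟩ := hb _ h2
  have hk := continuous_ramp η
  have hup : ∀ φ ∈ Q, dimFn φ (cfc (fun t => max (t - 2 * η) 0 ^ 2) a) ≤
      (φ (cfc (ramp η) a)).re - (φ (cfc (bump (3 * η / 2) (η / 4)) a)).re := by
    intro φ hφ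
    have := dimFn_cfc_le (hQ_state φ hφ) ha (g := fun t => max (t - 2 * η) 0 ^ 2)
      (h := fun t => ramp η t - bump (3 * η / 2) (η / 4) t) (by fun_prop) (hk.sub (continuous_bump _ _)) (fun t => by positivity)
      (fun ε t => fEps_sq_le_ramp_sub_bump hη ε t)
    rwa [cfc_sub (ramp η) _ a hk.continuousOn (continuous_bump _ _).continuousOn, map_sub,
      Complex.sub_re] at this
  have hlow : ∀ φ ∈ Q, (φ (cfc (ramp η) a)).re + (φ (cfc (bump (-(3 * η / 2)) (η / 4)) a)).re ≤
      dimFn φ (cfc (fun t => max (t + 2 * η) 0) a) := by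
    intro φ hφ
    have := le_dimFn_cfc (hQ_state φ hφ) ha (g := fun t => max (t + 2 * η) 0)
      (h := fun t => ramp η t + bump (-(3 * η / 2)) (η / 4) t) (by fun_prop) (hk.add (continuous_bump _ _)) (fun t => le_max_right _ _) hη4
      (fun ε t hε hε' => ramp_add_bump_le_fEps hη hε hε' t)
    rwa [cfc_add (a := a) (ramp η) _ hk.continuousOn (continuous_bump _ _).continuousOn, map_add,
      Complex.add_re] at this
  have hdim0 : ∀ φ ∈ Q, 0 ≤ dimFn φ (cfc (fun t => max (t - 2 * η) 0 ^ 2) a) := by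
    intro φ hφ
    have := le_dimFn_cfc (hQ_state φ hφ) ha (g := fun t => max (t - 2 * η) 0 ^ 2)
      (h := fun _ => 0) (by fun_prop) continuous_const (fun t => by positivity) one_pos
      (fun ε t _ _ => fEps_nonneg _ _)
    simpa using this
  have hdim1 : ∀ φ ∈ Q, dimFn φ (cfc (fun t => max (t + 2 * η) 0) a) ≤ 1 := by
    intro φ hφ
    have := dimFn_cfc_le (hQ_state φ hφ) ha (g := fun t => max (t + 2 * η) 0)
      (h := fun _ => 1) (by fun_prop) continuous_const (fun t => le_max_right _ _)
      (fun ε t => fEps_le_one _ _)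
    simpa [cfc_const_one ℝ a, (hQ_state φ hφ).map_one] using this
  -- The order on `Aff Q` demands strict inequalities; the same two gaps provide them.
  have hmem : affHat Q (cfc (ramp η) a) ∈ Set.Icc (0 : Aff Q) 1 := by
    constructor
    · refine ((Aff.lt_iff hQ_nonempty).mpr fun φ => ?_).le
      change 0 < ((φ : WeakDual ℂ A) (cfc (ramp η) a)).re
      linarith [hup φ φ.2, hdim0 φ φ.2, hφ₁ φ φ.2]
    · refine ((Aff.lt_iff hQ_nonempty).mpr fun φ => ?_).le
      change ((φ : WeakDual ℂ A) (cfc (ramp η) a)).re < 1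
      linarith [hlow φ φ.2, hdim1 φ φ.2, hφ₂ φ φ.2]
  obtain ⟨_, ⟨p, hpP, rfl⟩, hp⟩ :=
    Aff.exists_abs_sub_lt hQ_nonempty (h_gamma hmem) (lt_min hδ₁ hδ₂)
  refine ⟨p, hpP, fun φ hφ => ?_⟩
  have h3 : |(φ p).re - (φ (cfc (ramp η) a)).re| < min δ₁ δ₂ := hp ⟨φ, hφ⟩
  obtain ⟨h4, h5⟩ := abs_lt.mp h3
  have := min_le_left δ₁ δ₂
  have := min_le_right δ₁ δ₂
  constructor
  · linarith [hup φ hφ, hφ₁ φ hφ]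
  · linarith [hlow φ hφ, hφ₂ φ hφ]

theorem realRankZero_of_dense_isUnit (hd : Dense {a : A | IsUnit a})
    (hQ_state : ∀ φ ∈ Q, IsState φ) (hQ_nonempty : Q.Nonempty) (hQ_compact : IsCompact Q)
    (hP : ∀ p ∈ P, IsStarProjection p) (hS_dense : Dense (S : Set A)) (hS_cfc : ClosedUnderCFC S)
    (h_faithful : ∀ φ ∈ Q, IsFaithfulOn φ S)
    (h_alpha : ∀ a ∈ S, 0 ≤ a → ∀ p ∈ P, (∀ φ ∈ Q, dimFn φ a < (φ p).re) → CuntzLE a p)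
    (h_beta : ∀ a ∈ S, 0 ≤ a → ∀ p ∈ P, (∀ φ ∈ Q, (φ p).re < dimFn φ a) → CuntzLE p a)
    (h_gamma : Set.Icc (0 : Aff Q) 1 ⊆ closure (affHat Q '' P)) : RealRankZero A := by
  intro a₀ (ha₀ : IsSelfAdjoint a₀)
  rw [Metric.mem_closure_iff]
  intro ε hε
  obtain ⟨a, haS, ha, haa⟩ := exists_isSelfAdjoint_mem_norm_sub_lt hS_dense ha₀ (half_pos hε)
  suffices h : ∃ w, IsSelfAdjoint w ∧ IsUnit w ∧ ‖a - w‖ < ε / 2 by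
    obtain ⟨w, hw, hwu, hlt⟩ := h
    refine ⟨w, ⟨hw, hwu⟩, ?_⟩
    rw [dist_eq_norm, ← sub_add_sub_cancel a₀ a w]
    linarith [norm_add_le (a₀ - a) (a - w)]
  set η := ε / 8 with hη
  have hη0 : 0 < η := by positivity
  by_cases hspec : ∃ t : ℝ, |t| ≤ 2 * η ∧ t ∉ spectrum ℝ a
  · obtain ⟨t, ht, hta⟩ := hspec
    rw [spectrum.notMem_iff] at hta
    refine ⟨a - algebraMap ℝ A t, ha.sub (.algebraMap A (.all t)), by simpa using hta.neg, ?_⟩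
    rw [sub_sub_cancel, Algebra.algebraMap_eq_smul_one, norm_smul, Real.norm_eq_abs]
    have := (IsStarProjection.one A).norm_le
    nlinarith [abs_nonneg t, norm_nonneg (1 : A)]
  push Not at hspec
  obtain ⟨p, hpP, hp⟩ := exists_interpolating_projection hQ_state hQ_nonempty hQ_compact hS_cfc
    h_faithful h_gamma haS ha hη0
    (hspec _ (abs_le.mpr ⟨by linarith, by linarith⟩))
    (hspec _ (abs_le.mpr ⟨by linarith, by linarith⟩))
  set c := cfc (fun t : ℝ => max (t - 2 * η) 0) a with hc
  set b := cfc (fun t : ℝ => max (-t - 2 * η) 0) a with hb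
  set e := cfc (fun t : ℝ => max (t + 2 * η) 0) a with he
  have hc0 : 0 ≤ c := cfc_nonneg fun t _ => le_max_right _ _
  have hb0 : 0 ≤ b := cfc_nonneg fun t _ => le_max_right _ _
  have he0 : 0 ≤ e := cfc_nonneg fun t _ => le_max_right _ _
  have hcc : cfc (fun t : ℝ => max (t - 2 * η) 0 ^ 2) a = c * c := by
    rw [hc, ← cfc_mul (fun t : ℝ => max (t - 2 * η) 0) (fun t : ℝ => max (t - 2 * η) 0) a
      (by fun_prop) (by fun_prop)]
    simp only [pow_two]
  have hbe : b * e = 0 := by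
    rw [hb, he, ← cfc_mul (fun t : ℝ => max (-t - 2 * η) 0) (fun t : ℝ => max (t + 2 * η) 0) a
      (by fun_prop) (by fun_prop), ← cfc_zero ℝ a]
    refine cfc_congr fun t _ => mul_eq_zero.mpr ?_
    rcases le_total t (-2 * η) with h | h
    · exact Or.inr (max_eq_right (by linarith))
    · exact Or.inl (max_eq_right (by linarith))
  have hbc : b * c = 0 := by
    rw [hb, hc, ← cfc_mul (fun t : ℝ => max (-t - 2 * η) 0) (fun t : ℝ => max (t - 2 * η) 0) a
      (by fun_prop) (by fun_prop), ← cfc_zero ℝ a]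
    refine cfc_congr fun t _ => mul_eq_zero.mpr ?_
    rcases le_total t 0 with h | h
    · exact Or.inr (max_eq_right (by linarith))
    · exact Or.inl (max_eq_right (by linarith))
  have hcp : CuntzLE (c * c) p := by
    rw [← hcc]
    exact h_alpha _ (hS_cfc.cfc_mem haS ha (by fun_prop)) (cfc_nonneg fun t _ => by positivity)
      p hpP fun φ hφ => (hp φ hφ).1
  have hpe : CuntzLE p e := h_beta _ (hS_cfc.cfc_mem haS ha (by fun_prop)) he0 p hpP
    fun φ hφ => (hp φ hφ).2
  obtain ⟨q, hq, hqb, hcq⟩ := CuntzLE.exists_orthogonal (hP p hpP) he0 hb0.isSelfAdjoint hbe hpe hcp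
  obtain ⟨w, hw, hwu, hlt⟩ := exists_isUnit_norm_sub_lt hd hq hb0 hc0 hbc hqb hcq hη0
  refine ⟨w, hw, hwu, ?_⟩
  have hdist : ‖a - (c - b)‖ ≤ 2 * η := by
    have e1 : a - (c - b) =
        cfc (fun t : ℝ => t - (max (t - 2 * η) 0 - max (-t - 2 * η) 0)) a := by
      rw [cfc_sub (fun t : ℝ => t) (fun t => max (t - 2 * η) 0 - max (-t - 2 * η) 0) a
        (by fun_prop) (by fun_prop), cfc_sub (fun t : ℝ => max (t - 2 * η) 0)
        (fun t => max (-t - 2 * η) 0) a (by fun_prop) (by fun_prop), cfc_id' ℝ a]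
    rw [e1]
    refine norm_cfc_le (by positivity) fun t _ => ?_
    rw [Real.norm_eq_abs, abs_le]
    rcases max_cases (t - 2 * η) 0 with ⟨h, h'⟩ | ⟨h, h'⟩ <;>
      rcases max_cases (-t - 2 * η) 0 with ⟨k, k'⟩ | ⟨k, k'⟩ <;>
      rw [h, k] <;> constructor <;> linarith
  rw [← sub_add_sub_cancel a (c - b) w]
  linarith [norm_add_le (a - (c - b)) (c - b - w)]

end RealRank

/-! ### Pure infiniteness. -/

section PurelyInfinite

variable {Q : Set (WeakDual ℂ A)} {P : Set A} {S : NonUnitalStarSubalgebra ℂ A}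

theorem exists_ne_zero_eq_star_mul_mul (hQ_state : ∀ φ ∈ Q, IsState φ) (hQ_nonempty : Q.Nonempty)
    (hQ_compact : IsCompact Q) (hP : ∀ p ∈ P, IsStarProjection p) (hS_dense : Dense (S : Set A))
    (hS_cfc : ClosedUnderCFC S) (h_faithful : ∀ φ ∈ Q, IsFaithfulOn φ S)
    (h_beta : ∀ a ∈ S, 0 ≤ a → ∀ p ∈ P, (∀ φ ∈ Q, (φ p).re < dimFn φ a) → CuntzLE p a)
    (h_gamma : Set.Icc (0 : Aff Q) 1 ⊆ closure (affHat Q '' P))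
    {a : A} (ha : 0 ≤ a) (ha0 : a ≠ 0) : ∃ p ∈ P, p ≠ 0 ∧ ∃ w, star w * a * w = p := by
  have hna : 0 < ‖a‖ := norm_pos_iff.mpr ha0
  -- If `b ≤ r` then `a ≤ 2r < ‖a‖`, which is impossible; so `b` has spectrum above `r`.
  set r := ‖a‖ / 3 with hr
  have hr0 : 0 < r := by positivity
  obtain ⟨b, hbS, hb, hab⟩ := exists_isSelfAdjoint_mem_norm_sub_lt hS_dense ha.isSelfAdjoint hr0
  have hba : b - algebraMap ℝ A r ≤ a := by
    have h1 : b - a ≤ algebraMap ℝ A r := by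
      refine (hb.sub ha.isSelfAdjoint).le_algebraMap_norm_self.trans (algebraMap_mono A ?_)
      rw [norm_sub_rev]
      exact hab.le
    rw [sub_le_iff_le_add] at h1 ⊢
    rwa [add_comm]
  obtain ⟨t, ht, hrt⟩ : ∃ t ∈ spectrum ℝ b, r < t := by
    by_contra! hcon
    have h1 : b ≤ algebraMap ℝ A r := le_algebraMap_of_spectrum_le hcon
    have h2 : a ≤ algebraMap ℝ A (2 * r) := by
      have h3 : a - b ≤ algebraMap ℝ A r :=
        (ha.isSelfAdjoint.sub hb).le_algebraMap_norm_self.trans (algebraMap_mono A hab.le)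
      have := add_le_add h3 h1
      rwa [sub_add_cancel, ← map_add, ← two_mul] at this
    have h4 := (CStarAlgebra.norm_le_iff_le_algebraMap a (by positivity)).mpr h2
    linarith
  -- The cube gives `c = e (b - r) e ≤ e a e`, which transfers comparison from `c ∈ S` to `a`,
  -- itself perhaps outside `S`.
  set g : ℝ → ℝ := fun t => max (t - r) 0 ^ 3 with hg
  have hgc : Continuous g := by fun_prop
  have hg0 : ∀ t, 0 ≤ g t := fun t => by positivity
  set c := cfc g b with hc
  set e := cfc (fun t : ℝ => max (t - r) 0) b with he
  have hes : star e = e := (cfc_predicate _ b : IsSelfAdjoint e)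
  have hce : c ≤ e * a * e := by
    have h1 : c = e * (b - algebraMap ℝ A r) * e := by
      have h2 : b - algebraMap ℝ A r = cfc (fun t : ℝ => t - r) b := by
        rw [cfc_sub (fun t : ℝ => t) (fun _ => r) b (by fun_prop) (by fun_prop), cfc_id' ℝ b,
          cfc_const r b]
      rw [h2, he, ← cfc_mul _ _ b (by fun_prop) (by fun_prop), ← cfc_mul _ _ b (by fun_prop)
        (by fun_prop)]
      refine cfc_congr fun t _ => ?_
      rcases max_cases (t - r) 0 with ⟨h, h'⟩ | ⟨h, h'⟩ <;> simp only [hg, h] <;> ring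
    rw [h1]
    have := star_left_conjugate_le_conjugate hba e
    rwa [hes] at this
  have hgt : 0 < g t := by
    rw [hg]
    have : 0 < max (t - r) 0 := lt_max_of_lt_left (by linarith)
    positivity
  obtain ⟨δ, hδ0, hδ⟩ := exists_pos_le_re hQ_state hQ_nonempty hQ_compact h_faithful
    (a := cfc (fun s => fEps (g t) (g s)) b)
    (hS_cfc.cfc_mem hbS hb ((continuous_fEps _).comp hgc))
    (cfc_nonneg fun s _ => fEps_nonneg _ _)
    (cfc_ne_zero hb ((continuous_fEps _).comp hgc) ht
      (by rw [fEps_eq_one hgt le_rfl]; exact one_ne_zero))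
  -- Approximating this constant with an error below itself forces `0 < φ(p) < δ ≤ D_φ(c)`: `p` is
  -- nonzero and (β) applies.
  have hmem : min (δ / 2) (1 / 2) • (1 : Aff Q) ∈ Set.Icc (0 : Aff Q) 1 := by
    constructor
    · refine ((Aff.lt_iff hQ_nonempty).mpr fun φ => ?_).le
      change 0 < min (δ / 2) (1 / 2) * 1
      positivity
    · refine ((Aff.lt_iff hQ_nonempty).mpr fun φ => ?_).le
      change min (δ / 2) (1 / 2) * 1 < 1
      linarith [min_le_right (δ / 2) (1 / 2 : ℝ)]
  obtain ⟨_, ⟨p, hpP, rfl⟩, hp⟩ := Aff.exists_abs_sub_lt hQ_nonempty (h_gamma hmem)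
    (δ := min (δ / 2) (1 / 2)) (by positivity)
  have hp' : ∀ φ ∈ Q, 0 < (φ p).re ∧ (φ p).re < δ := by
    intro φ hφ
    have h1 : |(φ p).re - min (δ / 2) (1 / 2) * 1| < min (δ / 2) (1 / 2) := hp ⟨φ, hφ⟩
    obtain ⟨h2, h3⟩ := abs_lt.mp h1
    have := min_le_left (δ / 2) (1 / 2 : ℝ)
    constructor <;> linarith
  have hpc : CuntzLE p c := by
    refine h_beta c (hS_cfc.cfc_mem hbS hb hgc) (cfc_nonneg fun s _ => hg0 s) p hpP fun φ hφ => ?_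
    refine (hp' φ hφ).2.trans_le ((hδ φ hφ).trans ?_)
    refine le_dimFn_cfc (hQ_state φ hφ) hb hgc ((continuous_fEps _).comp hgc) hg0 hgt
      fun ε s hε hεt => ?_
    refine max_le_max le_rfl (min_le_min le_rfl ?_)
    have : 2 * g s / g t ≤ 2 * g s / ε :=
      div_le_div_of_nonneg_left (by linarith [hg0 s]) hε hεt
    linarith
  refine ⟨p, hpP, ?_, ?_⟩
  · rintro rfl
    obtain ⟨φ, hφ⟩ := hQ_nonempty
    simpa using (hp' φ hφ).1
  · obtain ⟨x, hx⟩ := hpc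
    obtain ⟨n, hn⟩ := (hx.eventually_lt_const one_pos).exists
    have hcs : IsSelfAdjoint (x n * c * star (x n)) :=
      (star_right_conjugate_nonneg (cfc_nonneg fun s _ => hg0 s) (x n)).isSelfAdjoint
    have h1 : p - x n * (e * a * e) * star (x n) ≤ algebraMap ℝ A ‖p - x n * c * star (x n)‖ :=
      (sub_le_sub_left (star_right_conjugate_le_conjugate hce (x n)) p).trans
        ((hP p hpP).isSelfAdjoint.sub hcs).le_algebraMap_norm_self
    obtain ⟨w, hw⟩ := exists_star_mul_mul_eq (hP p hpP) (norm_nonneg _) hn h1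
    refine ⟨e * star (x n) * w, ?_⟩
    rw [← hw]
    simp only [star_mul, star_star, hes, mul_assoc]

/-- If below every nonzero positive element there is an infinite full projection, then the algebra
is simple and purely infinite. -/
theorem isSimplePurelyInfinite_of_exists [Nontrivial A]
    (h : ∀ a : A, 0 ≤ a → a ≠ 0 →
      ∃ p : A, IsInfiniteProjection p ∧ IsFull p ∧ ∃ w, star w * a * w = p) :
    IsSimplePurelyInfinite A := by
  have hpos : ∀ x : A, x ≠ 0 → 0 ≤ star x * x ∧ star x * x ≠ 0 := fun x hx =>
    ⟨star_mul_self_nonneg x, (CStarRing.star_mul_self_ne_zero_iff x).mpr hx⟩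
  refine ⟨⟨inferInstance, fun I hI => ?_⟩, fun B hB ⟨x, hxB, hx⟩ => ?_⟩
  · by_cases hbot : I = ⊥
    · exact Or.inl hbot
    right
    obtain ⟨x, hxI, hx⟩ : ∃ x ∈ I, x ≠ 0 := by
      by_contra! hcon
      exact hbot (le_bot_iff.mp fun x hx => by simpa using hcon x hx)
    obtain ⟨p, -, hfull, w, hw⟩ := h _ (hpos x hx).1 (hpos x hx).2
    have hpI : p ∈ I := by
      rw [← hw]
      exact I.mul_mem_right _ _ (I.mul_mem_left _ _ (I.mul_mem_left _ _ hxI))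
    have hspan : TwoSidedIdeal.span {p} ≤ I := by
      rw [TwoSidedIdeal.span_le]
      simpa using hpI
    have hsub : closure (TwoSidedIdeal.span {p} : Set A) ⊆ I := closure_minimal hspan hI
    rw [hfull] at hsub
    exact top_le_iff.mp fun y _ => hsub (Set.mem_univ y)
  · obtain ⟨ha, ha0⟩ := hpos x hx
    set a := star x * x with hadef
    have haB : a ∈ B := mul_mem (star_mem hxB) hxB
    obtain ⟨p, hinf, -, w, hw⟩ := h a ha ha0
    set d := CFC.sqrt a with hd
    have hdd : d * d = a := CFC.sqrt_mul_sqrt_self a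
    have hds : star d = d := (CFC.sqrt_nonneg a).isSelfAdjoint
    have hv : star (d * w) * (d * w) = p := by
      rw [← hw, ← hdd, star_mul, hds]
      simp only [mul_assoc]
    -- With `v = d w`, the projection `v v* = d w w* d ≤ ‖w‖² a` lies in `B` and is equivalent to
    -- the infinite `p = v* v`.
    refine ⟨_, hB.mem_of_le _ ((‖w‖ ^ 2) • a) (mul_star_self_nonneg _) ?_ ?_, hinf.of_equiv hv⟩
    · have h1 : w * star w ≤ algebraMap ℝ A (‖w‖ ^ 2) :=
        CStarAlgebra.mul_star_le_algebraMap_norm_sq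
      have h2 := star_right_conjugate_le_conjugate h1 d
      rw [hds, ← Algebra.commutes, mul_assoc _ d d, hdd, ← Algebra.smul_def] at h2
      simpa only [star_mul, hds, mul_assoc] using h2
    · rw [← Complex.coe_smul]
      exact SMulMemClass.smul_mem _ haB

end PurelyInfinite

end CStarComparison

open CStarComparison in
theorem theorem1p5 {A : Type*} [CStarAlgebra A] [PartialOrder A] [StarOrderedRing A]
    (Q : Set (WeakDual ℂ A)) (hQ_state : ∀ φ ∈ Q, IsState φ) (hQ_nonempty : Q.Nonempty)
    (hQ_compact : IsCompact Q) (hQ_convex : Convex ℝ Q)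
    (P : Set A) (hP : ∀ p ∈ P, IsStarProjection p)
    (S : NonUnitalStarSubalgebra ℂ A) (hS_dense : Dense (S : Set A)) (hS_cfc : ClosedUnderCFC S)
    (h_faithful : ∀ φ ∈ Q, IsFaithfulOn φ S)
    (h_alpha : ∀ a ∈ S, 0 ≤ a → ∀ p ∈ P, (∀ φ ∈ Q, dimFn φ a < (φ p).re) → CuntzLE a p)
    (h_beta : ∀ a ∈ S, 0 ≤ a → ∀ p ∈ P, (∀ φ ∈ Q, (φ p).re < dimFn φ a) → CuntzLE p a)
    (h_gamma : Set.Icc (0 : Aff Q) 1 ⊆ closure (affHat Q '' P)) :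
    (stableRank A = 1 → RealRankZero A) ∧
      ((∀ p ∈ P, p ≠ 0 → IsInfiniteProjection p ∧ IsFull p) → IsSimplePurelyInfinite A) := by
  refine ⟨fun h => realRankZero_of_dense_isUnit (dense_isUnit_of_stableRank_eq_one h) hQ_state
    hQ_nonempty hQ_compact hP hS_dense hS_cfc h_faithful h_alpha h_beta h_gamma, fun h => ?_⟩
  have : Nontrivial A := by
    obtain ⟨φ, hφ⟩ := hQ_nonempty
    refine ⟨⟨1, 0, fun h10 => ?_⟩⟩
    have := (hQ_state φ hφ).map_one
    rw [h10, map_zero] at this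
    exact zero_ne_one this
  refine isSimplePurelyInfinite_of_exists fun a ha ha0 => ?_
  obtain ⟨p, hpP, hp0, hw⟩ := exists_ne_zero_eq_star_mul_mul hQ_state hQ_nonempty hQ_compact hP
    hS_dense hS_cfc h_faithful h_beta h_gamma ha ha0
  exact ⟨p, (h p hpP hp0).1, (h p hpP hp0).2, hw⟩
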